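/- Let $A$ be a C*-algebra (not necessarily unital). For $N\subseteq A$ put $N_+=\{n^*n:n\in N\}$ and let $B=C^*(N_+)$ be the C*-subalgebra of $A$ generated by $N_+$. Suppose that $N$ is a Cartan semigroup, i.e. 1. $N$ is norm-closed, closed under products and adjoints, and has dense linear span in $A$; 2. $B$ is commutative and $B\subseteq N$; 3. there is a linear map $E:A\to A$ which is contractive and idempotent with range $B$ and which is stable, i.e. $E(n)n^*\in B$ for all $n\in N$. Fix such an $E$. For $m,n\in N$ write $m<n$ ($n$ dominates $m$) if there is $s\in N$ with $sm,ms,sn,ns\in B$ and $nsm=m=msn$. For $T\subseteq N$ put $T^<=\{s\in N: t<s\text{ for some }t\in T\}$. A filter is a subset $F\subseteq N$ such that, for all $m,n\in N$, one has $m,n\in F$ if and only if there is $l\in F$ with $l<m$ and $l<n$. An ultrafilter is a nonempty proper filter that is maximal among the proper filters. Let $G$ be the set of ultrafilters, with the topology generated by the sets $\mathcal U_n=\{U\in G:n\in U\}$, $n\in N$. Then $G$ is a groupoid under the product $T\cdot U=(TU)^<$, which is defined if and only if $0\notin TU$, with inverse $U^{-1}=U^*=\{u^*:u\in U\}$. This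 groupoid is étale, i.e. its topology has a basis of open bisections that is closed under pointwise products and inverses (where $O\subseteq G$ is a bisection if $O^{-1}O$ and $OO^{-1}$ consist of units). Moreover, $G$ is Hausdorff, and its non-unit elements are exactly the ultrafilters that contain an element annihilated by $E$: $$G\setminus G^{(0)}=\bigcup_{n\in N,\ E(n)=0}\mathcal U_n .$$ -/

import Mathlib

open scoped Pointwise

/-! ## Groupoids given by their set of arrows -/

/-- A groupoid, presented by its set of arrows `G`: a partially defined product
(`Comp g h` says that `g * h` is defined), and a total inversion. -/
structure ArrowGroupoid (G : Type*) where
  /-- the pair `(g, h)` is composable -/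
  Comp : G → G → Prop
  /-- the product of a composable pair -/
  mul : ∀ g h : G, Comp g h → G
  /-- the inverse of an arrow -/
  inv : G → G
  inv_inv : ∀ g, inv (inv g) = g
  assoc : ∀ (g h k : G) (hgh : Comp g h) (hhk : Comp h k),
    ∃ (h₁ : Comp (mul g h hgh) k) (h₂ : Comp g (mul h k hhk)),
      mul (mul g h hgh) k h₁ = mul g (mul h k hhk) h₂
  comp_inv_self : ∀ g, Comp (inv g) g
  comp_self_inv : ∀ g, Comp g (inv g)
  inv_mul_cancel : ∀ (g h : G) (hgh : Comp g h),
    ∃ h₁ : Comp (inv g) (mul g h hgh), mul (inv g) (mul g h hgh) h₁ = h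
  mul_inv_cancel : ∀ (g h : G) (hgh : Comp g h),
    ∃ h₁ : Comp (mul g h hgh) (inv h), mul (mul g h hgh) (inv h) h₁ = g

namespace ArrowGroupoid

variable {G : Type*} (𝒢 : ArrowGroupoid G)

/-- The source `g⁻¹ g` of an arrow. -/
def src (g : G) : G := 𝒢.mul (𝒢.inv g) g (𝒢.comp_inv_self g)

/-- The range `g g⁻¹` of an arrow. -/
def rng (g : G) : G := 𝒢.mul g (𝒢.inv g) (𝒢.comp_self_inv g)

/-- The unit space `G⁽⁰⁾`. -/
def units : Set G := Set.range 𝒢.src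

/-- The pointwise product of two sets of arrows. -/
def setMul (O P : Set G) : Set G :=
  {k | ∃ g ∈ O, ∃ h ∈ P, ∃ hgh : 𝒢.Comp g h, 𝒢.mul g h hgh = k}

/-- The pointwise inverse of a set of arrows. -/
def setInv (O : Set G) : Set G := 𝒢.inv '' O

/-- `O` is a bisection if `O⁻¹O` and `OO⁻¹` consist of units. -/
def IsBisection (O : Set G) : Prop :=
  𝒢.setMul (𝒢.setInv O) O ⊆ 𝒢.units ∧ 𝒢.setMul O (𝒢.setInv O) ⊆ 𝒢.units

/-- A groupoid with a topology is étale if the topology has a basis of (open) bisections which is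
closed under pointwise products and inverses. -/
def IsEtale [TopologicalSpace G] : Prop :=
  ∃ 𝓑 : Set (Set G), TopologicalSpace.IsTopologicalBasis 𝓑 ∧
    (∀ O ∈ 𝓑, 𝒢.IsBisection O) ∧
    (∀ O ∈ 𝓑, ∀ P ∈ 𝓑, 𝒢.setMul O P ∈ 𝓑) ∧
    (∀ O ∈ 𝓑, 𝒢.setInv O ∈ 𝓑)

end ArrowGroupoid

/-! ## Cartan semigroups -/

section Cartan

variable {A : Type*} [NonUnitalCStarAlgebra A]

/-- The positive cone `N₊ = {n* n : n ∈ N}`. -/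
def posCone (N : Set A) : Set A := {a | ∃ n ∈ N, a = star n * n}

/-- `B = C*(N₊)`, the C*-subalgebra generated by the positive cone of `N`. -/
def semiCartan (N : Set A) : NonUnitalStarSubalgebra ℂ A :=
  (NonUnitalStarAlgebra.adjoin ℂ (posCone N)).topologicalClosure

/-- `E` is an expectation of `A` onto `B` (a contractive idempotent linear map with range `B`) which
is stable with respect to `N`, where `B = C*(N₊)`. -/
structure IsStableExpectation (N : Set A) (E : A →ₗ[ℂ] A) : Prop where
  contractive : ∀ a, ‖E a‖ ≤ ‖a‖
  idempotent : ∀ a, E (E a) = E a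
  range_eq : Set.range E = (semiCartan N : Set A)
  stable : ∀ n ∈ N, E n * star n ∈ semiCartan N

/-- `N` is a Cartan semigroup in the C*-algebra `A`. -/
structure IsCartanSemigroup (N : Set A) : Prop where
  isClosed : IsClosed N
  mul_mem : ∀ m ∈ N, ∀ n ∈ N, m * n ∈ N
  star_mem : ∀ n ∈ N, star n ∈ N
  dense_span : Dense (Submodule.span ℂ N : Set A)
  semiCartan_comm : ∀ a ∈ semiCartan N, ∀ b ∈ semiCartan N, a * b = b * a
  semiCartan_subset : (semiCartan N : Set A) ⊆ N
  exists_expectation : ∃ E : A →ₗ[ℂ] A, IsStableExpectation N E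

/-! ## Domination, filters and ultrafilters -/

/-- `m <ₛ n`. -/
structure DominatesVia (N : Set A) (m s n : A) : Prop where
  left_mem : m ∈ N
  via_mem : s ∈ N
  right_mem : n ∈ N
  via_left : s * m ∈ semiCartan N
  left_via : m * s ∈ semiCartan N
  via_right : s * n ∈ semiCartan N
  right_via : n * s ∈ semiCartan N
  right_eq : n * s * m = m
  left_eq : m * s * n = m

/-- The domination relation `m < n` on `N`. -/
def Dominated (N : Set A) (m n : A) : Prop := ∃ s, DominatesVia N m s n

/-- The up-set `T^<` of `T` with respect to domination. -/
def upSet (N : Set A) (T : Set A) : Set A := {s | ∃ t ∈ T, Dominated N t s}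

/-- Filters with respect to domination. -/
def IsDomFilter (N : Set A) (F : Set A) : Prop :=
  F ⊆ N ∧ ∀ m ∈ N, ∀ n ∈ N,
    (m ∈ F ∧ n ∈ F ↔ ∃ l ∈ F, Dominated N l m ∧ Dominated N l n)

/-- Ultrafilters: (nonempty) maximal proper filters. -/
structure IsDomUltrafilter (N : Set A) (U : Set A) : Prop where
  nonempty : U.Nonempty
  isFilter : IsDomFilter N U
  proper : U ≠ N
  maximal : ∀ F, IsDomFilter N F → F ≠ N → U ⊆ F → F = U

/-- The set `G` of ultrafilters of `N`. -/
def DomUltrafilter (N : Set A) : Type _ := {U : Set A // IsDomUltrafilter N U}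

/-- The underlying subset of `N` of an ultrafilter. -/
def DomUltrafilter.carrier {N : Set A} (U : DomUltrafilter N) : Set A := U.1

/-- `𝒰ₙ`, the set of ultrafilters containing `n`. -/
def basicOpen (N : Set A) (n : A) : Set (DomUltrafilter N) := {U | n ∈ U.carrier}

/-- The topology on `G` generated by the sets `𝒰ₙ`, for `n ∈ N`. -/
instance (N : Set A) : TopologicalSpace (DomUltrafilter N) :=
  TopologicalSpace.generateFrom {O | ∃ n ∈ N, O = basicOpen N n}

/-- `𝒢` is the groupoid of ultrafilters: `T · U` is defined iff `0 ∉ TU`, in which case it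
is `(TU)^<`, and `U⁻¹ = U* = {u* : u ∈ U}`. -/
structure IsUltrafilterGroupoid (N : Set A) (𝒢 : ArrowGroupoid (DomUltrafilter N)) : Prop where
  comp_iff : ∀ T U : DomUltrafilter N, 𝒢.Comp T U ↔ (0 : A) ∉ T.carrier * U.carrier
  mul_eq : ∀ (T U : DomUltrafilter N) (h : 𝒢.Comp T U),
    (𝒢.mul T U h).carrier = upSet N (T.carrier * U.carrier)
  inv_eq : ∀ U : DomUltrafilter N, (𝒢.inv U).carrier = star '' U.carrier

end Cartan

/-! The groupoid and its étale topology need no expectation. Functional calculus in `B` shows that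
each `n ∈ N` is a limit of elements `n(n*n)d` with `d ∈ B`. Hence `sn ∈ B` implies `sBn ⊆ B`
(`mul_mul_mem`), and this makes domination multiplicative. Filters then multiply. Maximality of
products comes from cancellation: a proper filter `F ⊇ (TU)^<` satisfies `(T*F)^< = U`, so `F ⊆
(TT*F)^< = (TU)^<`. Units are the ultrafilters meeting `B`. Products of open sets are open because
an ultrafilter containing `m'n'`, with `m' < m` and `n' < n`, factors through ultrafilters
containing `m` and `n`. The expectation enters through a Tomiyama-type argument with characters of
`B`, giving `E(nc) = E(n)c`. For `b = E(u)`, stability gives `ub* = bb*`, so `bb*` agrees with `u*u`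
wherever it is nonzero. This splits an element of the source of an ultrafilter into orthogonal parts
`f`, `g` with `uf ∈ B` and `E(ug) = 0`. Primeness of unit ultrafilters selects one part, which
identifies the non-units. Applied to `T⁻¹U`, the same dichotomy separates distinct ultrafilters. -/

theorem NonUnitalCStarAlgebra.exists_norm_sub_mul_le {D : Type*} [NonUnitalCStarAlgebra D] {a : D}
    (ha : IsSelfAdjoint a) {δ : ℝ} (hδ : 0 < δ) :
    ∃ d : D, IsSelfAdjoint d ∧
      ‖a - a * a * d - d * (a * a) + d * (a * a * a) * d‖ ≤ δ := by
  have hpos : ∀ t : ℝ, 0 < t ^ 2 + δ ^ 2 := fun t => by positivity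
  -- A regularised inverse: the expression to bound is `t(1 - t f(t))²`, and `1 - t f(t) = δ²/(t² +
  -- δ²)`.
  set f : ℝ → ℝ := fun t => t / (t ^ 2 + δ ^ 2) with hf
  have hfc : Continuous f := by
    refine continuous_id.div (by fun_prop) fun t => (hpos t).ne'
  have hf0 : f 0 = 0 := by simp [hf]
  refine ⟨cfcₙ f a, cfcₙ_predicate f a, ?_⟩
  have key : a - a * a * cfcₙ f a - cfcₙ f a * (a * a) + cfcₙ f a * (a * a * a) * cfcₙ f a
      = cfcₙ (fun t => t - t * t * f t - f t * (t * t) + f t * (t * t * t) * f t) a := by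
    rw [cfcₙ_add .., cfcₙ_sub .., cfcₙ_sub .., cfcₙ_mul .., cfcₙ_mul .., cfcₙ_mul .., cfcₙ_mul ..,
      cfcₙ_mul .., cfcₙ_mul .., cfcₙ_mul .., cfcₙ_mul .., cfcₙ_id' ..]
  rw [key]
  refine norm_cfcₙ_le fun t _ => ?_
  have h1 : t - t * t * f t - f t * (t * t) + f t * (t * t * t) * f t
      = t * δ ^ 4 / (t ^ 2 + δ ^ 2) ^ 2 := by
    have := (hpos t).ne'
    simp only [hf]
    field_simp
    ring
  have hsq : 0 < (t ^ 2 + δ ^ 2) ^ 2 := pow_pos (hpos t) 2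
  rw [h1, norm_div, norm_mul, Real.norm_eq_abs, Real.norm_eq_abs, Real.norm_eq_abs,
    abs_of_pos (pow_pos hδ 4), abs_of_pos hsq, div_le_iff₀ hsq]
  have h2 : |t| * δ ≤ t ^ 2 + δ ^ 2 := by
    nlinarith [sq_abs t, sq_nonneg (|t| - δ), abs_nonneg t]
  have h3 : |t| * δ * δ ^ 2 ≤ (t ^ 2 + δ ^ 2) * (t ^ 2 + δ ^ 2) :=
    mul_le_mul h2 (by nlinarith) (by positivity) (hpos t).le
  calc |t| * δ ^ 4 = δ * (|t| * δ * δ ^ 2) := by ring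
    _ ≤ δ * ((t ^ 2 + δ ^ 2) * (t ^ 2 + δ ^ 2)) := by gcongr
    _ = δ * (t ^ 2 + δ ^ 2) ^ 2 := by ring

/-! ### Approximation inside `N` and normalisation of `B` -/

section Cartan

variable {A : Type*} [NonUnitalCStarAlgebra A] {N : Set A}

instance isClosed_semiCartan : IsClosed (semiCartan N : Set A) :=
  NonUnitalStarSubalgebra.isClosed_topologicalClosure _

theorem posCone_subset_semiCartan : posCone N ⊆ semiCartan N :=
  (NonUnitalStarAlgebra.subset_adjoin ℂ _).trans
    (NonUnitalStarSubalgebra.le_topologicalClosure _)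

theorem star_mul_self_mem_semiCartan {n : A} (hn : n ∈ N) : star n * n ∈ semiCartan N :=
  posCone_subset_semiCartan ⟨n, hn, rfl⟩

/-- With `a = n*n`, the C*-identity turns `‖n - nad‖²` into the norm of `a - a²d - da² + da³d`,
which is small for a suitable `d ∈ B`. -/
theorem mem_closure_image_mul_semiCartan {n : A} (hn : n ∈ N) :
    n ∈ closure ((fun d => n * (star n * n) * d) '' (semiCartan N : Set A)) := by
  rw [Metric.mem_closure_iff]
  intro ε hε
  set a : semiCartan N := ⟨star n * n, star_mul_self_mem_semiCartan hn⟩ with ha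
  have hsa : IsSelfAdjoint a := by
    apply Subtype.ext; simp [ha]
  obtain ⟨d, hd, hle⟩ := NonUnitalCStarAlgebra.exists_norm_sub_mul_le hsa
    (show 0 < (ε / 2) ^ 2 by positivity)
  refine ⟨_, ⟨d, d.2, rfl⟩, ?_⟩
  rw [dist_eq_norm]
  have hd' : star (d : A) = d := congrArg Subtype.val hd
  have h : ‖n - n * (star n * n) * d‖ ^ 2 ≤ (ε / 2) ^ 2 := by
    rw [sq, ← CStarRing.norm_star_mul_self]
    convert hle using 1
    change _ = ‖((a - a * a * d - d * (a * a) + d * (a * a * a) * d : semiCartan N) : A)‖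
    congr 1
    simp only [ha]
    push_cast
    simp only [star_sub, star_mul, star_star, hd', mul_sub, sub_mul, mul_assoc]
    abel
  have := abs_le_of_sq_le_sq h (by positivity)
  have := le_abs_self ‖n - n * (star n * n) * (d : A)‖
  simp only at *
  linarith

namespace IsCartanSemigroup

variable (hN : IsCartanSemigroup N)
include hN

theorem mul_star_self_mem {n : A} (hn : n ∈ N) : n * star n ∈ semiCartan N := by
  simpa using star_mul_self_mem_semiCartan (hN.star_mem n hn)

theorem comm {a b : A} (ha : a ∈ semiCartan N) (hb : b ∈ semiCartan N) : a * b = b * a :=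
  hN.semiCartan_comm a ha b hb

theorem mem {a : A} (ha : a ∈ semiCartan N) : a ∈ N := hN.semiCartan_subset ha

theorem zero_mem : (0 : A) ∈ N := hN.mem (semiCartan N).zero_mem

/-- Positive elements `c*c` span `B`, and `n*c*cn = (cn)*(cn)` lies in `N₊`. -/
theorem star_mul_mul_mem {n b : A} (hn : n ∈ N) (hb : b ∈ semiCartan N) :
    star n * b * n ∈ semiCartan N := by
  let : PartialOrder (semiCartan N) := CStarAlgebra.spectralOrder _
  let : StarOrderedRing (semiCartan N) := CStarAlgebra.spectralOrderedRing _
  have h : (⟨b, hb⟩ : semiCartan N) ∈ Submodule.span ℂ {a : semiCartan N | 0 ≤ a} := by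
    rw [CStarAlgebra.span_nonneg]; trivial
  suffices H : ∀ x ∈ Submodule.span ℂ {a : semiCartan N | 0 ≤ a},
      star n * (x : A) * n ∈ semiCartan N from H _ h
  intro x hx
  induction hx using Submodule.span_induction with
  | mem x hx =>
    obtain ⟨c, rfl⟩ := CStarAlgebra.nonneg_iff_eq_star_mul_self.mp (Set.mem_ofPred.mp hx)
    have := star_mul_self_mem_semiCartan (hN.mul_mem _ (hN.mem c.2) _ hn)
    simpa [mul_assoc] using this
  | zero => simp
  | add x y _ _ hx hy => simpa [mul_add, add_mul] using add_mem hx hy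
  | smul r x _ hx => simpa [mul_smul_comm, smul_mul_assoc] using SMulMemClass.smul_mem r hx

theorem mul_mul_star_mem {n b : A} (hn : n ∈ N) (hb : b ∈ semiCartan N) :
    n * b * star n ∈ semiCartan N := by
  simpa using hN.star_mul_mul_mem (hN.star_mem n hn) hb

/-- The subalgebra `B` may be inserted in products that belong to `B`. -/
theorem mul_mul_mem {s n b : A} (hn : n ∈ N) (hsn : s * n ∈ semiCartan N)
    (hb : b ∈ semiCartan N) : s * b * n ∈ semiCartan N := by
  have hcl : IsClosed {x : A | s * b * x ∈ semiCartan N} :=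
    isClosed_semiCartan.preimage (by fun_prop : Continuous fun x : A => s * b * x)
  refine hcl.closure_subset_iff.mpr ?_ (mem_closure_image_mul_semiCartan hn)
  rintro _ ⟨d, hd, rfl⟩
  -- The factor `nn*` lets `b` pass to the right of `n`, where it becomes `n*bn ∈ B`.
  have h1 := hN.comm hb (hN.mul_star_self_mem hn)
  have : s * b * (n * (star n * n) * d) = s * n * (star n * b * n * d) := by
    calc _ = s * (b * (n * star n)) * n * d := by simp only [mul_assoc]
      _ = _ := by rw [h1]; simp only [mul_assoc]
  simp only [Set.mem_ofPred_eq, this]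
  exact MulMemClass.mul_mem hsn (MulMemClass.mul_mem (hN.star_mul_mul_mem hn hb) hd)

end IsCartanSemigroup
end Cartan

section Cartan

variable {A : Type*} [NonUnitalCStarAlgebra A] {N : Set A}

/-! ## Domination -/

namespace DominatesVia

theorem trans {m s n t p : A} (h : DominatesVia N m s n) (h' : DominatesVia N n t p) :
    DominatesVia N m t p where
  left_mem := h.left_mem
  via_mem := h'.via_mem
  right_mem := h'.right_mem
  via_left := by
    have : t * m = (t * n) * (s * m) := by conv_lhs => rw [← h.right_eq]
                                           simp only [mul_assoc]
    rw [this]; exact mul_mem h'.via_left h.via_left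
  left_via := by
    have : m * t = (m * s) * (n * t) := by conv_lhs => rw [← h.left_eq]
                                           simp only [mul_assoc]
    rw [this]; exact mul_mem h.left_via h'.left_via
  via_right := h'.via_right
  right_via := h'.right_via
  right_eq := by
    calc p * t * m = p * t * (n * s * m) := by rw [h.right_eq]
      _ = (p * t * n) * s * m := by simp only [mul_assoc]
      _ = m := by rw [h'.right_eq, h.right_eq]
  left_eq := by
    calc m * t * p = (m * s * n) * t * p := by rw [h.left_eq]
      _ = m * s * (n * t * p) := by simp only [mul_assoc]
      _ = m := by rw [h'.left_eq, h.left_eq]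

variable (hN : IsCartanSemigroup N)
include hN

protected theorem mul {m s n m' s' n' : A} (h : DominatesVia N m s n)
    (h' : DominatesVia N m' s' n') : DominatesVia N (m * m') (s' * s) (n * n') where
  left_mem := hN.mul_mem _ h.left_mem _ h'.left_mem
  via_mem := hN.mul_mem _ h'.via_mem _ h.via_mem
  right_mem := hN.mul_mem _ h.right_mem _ h'.right_mem
  via_left := by
    simpa only [mul_assoc] using hN.mul_mul_mem h'.left_mem h'.via_left h.via_left
  left_via := by
    simpa only [mul_assoc] using hN.mul_mul_mem h.via_mem h.left_via h'.left_via
  via_right := by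
    simpa only [mul_assoc] using hN.mul_mul_mem h'.right_mem h'.via_right h.via_right
  right_via := by
    simpa only [mul_assoc] using hN.mul_mul_mem h.via_mem h.right_via h'.right_via
  right_eq := by
    calc n * n' * (s' * s) * (m * m') = n * ((n' * s') * (s * m)) * m' := by
          simp only [mul_assoc]
      _ = n * s * m * (n' * s' * m') := by
          rw [hN.comm h'.right_via h.via_left]; simp only [mul_assoc]
      _ = m * m' := by rw [h.right_eq, h'.right_eq]
  left_eq := by
    calc m * m' * (s' * s) * (n * n') = m * ((m' * s') * (s * n)) * n' := by
          simp only [mul_assoc]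
      _ = m * s * n * (m' * s' * n') := by
          rw [hN.comm h'.left_via h.via_right]; simp only [mul_assoc]
      _ = m * m' := by rw [h.left_eq, h'.left_eq]

protected theorem star {m s n : A} (h : DominatesVia N m s n) :
    DominatesVia N (star m) (star s) (star n) where
  left_mem := hN.star_mem _ h.left_mem
  via_mem := hN.star_mem _ h.via_mem
  right_mem := hN.star_mem _ h.right_mem
  via_left := by simpa using star_mem h.left_via
  left_via := by simpa using star_mem h.via_left
  via_right := by simpa using star_mem h.right_via
  right_via := by simpa using star_mem h.via_right
  right_eq := by simpa [mul_assoc] using congrArg star h.left_eq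
  left_eq := by simpa [mul_assoc] using congrArg star h.right_eq

theorem mul_right_mem {w s u b : A} (h : DominatesVia N w s u) (hb : b ∈ semiCartan N) :
    DominatesVia N (w * b) s u where
  left_mem := hN.mul_mem _ h.left_mem _ (hN.mem hb)
  via_mem := h.via_mem
  right_mem := h.right_mem
  via_left := by simpa only [mul_assoc] using mul_mem h.via_left hb
  left_via := hN.mul_mul_mem h.via_mem h.left_via hb
  via_right := h.via_right
  right_via := h.right_via
  right_eq := by rw [← mul_assoc, h.right_eq]
  left_eq := by
    calc w * b * s * u = w * (b * (s * u)) := by simp only [mul_assoc]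
      _ = w * s * u * b := by rw [hN.comm hb h.via_right]; simp only [mul_assoc]
      _ = w * b := by rw [h.left_eq]

theorem mem_left_mul {w s u b : A} (h : DominatesVia N w s u) (hb : b ∈ semiCartan N) :
    DominatesVia N (b * w) s u := by
  simpa using ((h.star hN).mul_right_mem hN (star_mem hb)).star hN

end DominatesVia

namespace Dominated

theorem left_mem {m n : A} (h : Dominated N m n) : m ∈ N := h.choose_spec.left_mem

theorem right_mem {m n : A} (h : Dominated N m n) : n ∈ N := h.choose_spec.right_mem

theorem trans {m n p : A} (h : Dominated N m n) (h' : Dominated N n p) : Dominated N m p :=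
  ⟨_, h.choose_spec.trans h'.choose_spec⟩

theorem eq_zero {m : A} (h : Dominated N m 0) : m = 0 := by
  obtain ⟨s, hs⟩ := h
  simpa using hs.right_eq.symm

variable (hN : IsCartanSemigroup N)
include hN

protected theorem mul {m n m' n' : A} (h : Dominated N m n) (h' : Dominated N m' n') :
    Dominated N (m * m') (n * n') :=
  ⟨_, h.choose_spec.mul hN h'.choose_spec⟩

protected theorem star {m n : A} (h : Dominated N m n) : Dominated N (star m) (star n) :=
  ⟨_, h.choose_spec.star hN⟩

theorem mul_right_mem {w u b : A} (h : Dominated N w u) (hb : b ∈ semiCartan N) :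
    Dominated N (w * b) u :=
  ⟨_, h.choose_spec.mul_right_mem hN hb⟩

theorem mem_left_mul {w u b : A} (h : Dominated N w u) (hb : b ∈ semiCartan N) :
    Dominated N (b * w) u :=
  ⟨_, h.choose_spec.mem_left_mul hN hb⟩

theorem zero_left {n : A} (hn : n ∈ N) : Dominated N 0 n :=
  ⟨star n, hN.zero_mem, hN.star_mem n hn, hn, by simp, by simp,
    star_mul_self_mem_semiCartan hn, hN.mul_star_self_mem hn, by simp, by simp⟩

omit hN in
/-- Elements dominated by an element of `B` lie in `B`. -/
theorem mem_semiCartan {m b : A} (h : Dominated N m b) (hb : b ∈ semiCartan N) :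
    m ∈ semiCartan N := by
  obtain ⟨s, hs⟩ := h
  rw [← hs.left_eq]
  exact mul_mem hs.left_via hb

end Dominated

/-! ## Filters -/

theorem subset_upSet {S : Set A} (h : ∀ a ∈ S, ∃ c ∈ S, Dominated N c a) : S ⊆ upSet N S :=
  h

theorem upSet_mono {S T : Set A} (h : S ⊆ T) : upSet N S ⊆ upSet N T :=
  fun _ ⟨t, ht, hts⟩ => ⟨t, h ht, hts⟩

theorem upSet_subset (S : Set A) : upSet N S ⊆ N := fun _ ⟨_, _, h⟩ => h.right_mem

theorem zero_mem_of_zero_mem_upSet {S : Set A} (h : (0 : A) ∈ upSet N S) : (0 : A) ∈ S := by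
  obtain ⟨t, ht, h0⟩ := h
  rwa [h0.eq_zero] at ht

/-- The up-set of a set directed downwards by domination is a filter. -/
theorem isDomFilter_upSet {S : Set A}
    (h : ∀ a ∈ S, ∀ b ∈ S, ∃ c ∈ S, Dominated N c a ∧ Dominated N c b) :
    IsDomFilter N (upSet N S) := by
  refine ⟨upSet_subset S, fun m _ n _ => ⟨?_, ?_⟩⟩
  · rintro ⟨⟨a, ha, ham⟩, b, hb, hbn⟩
    obtain ⟨c, hc, hca, hcb⟩ := h a ha b hb
    obtain ⟨d, hd, hdc, -⟩ := h c hc c hc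
    exact ⟨c, ⟨d, hd, hdc⟩, hca.trans ham, hcb.trans hbn⟩
  · rintro ⟨l, ⟨a, ha, hal⟩, hlm, hln⟩
    exact ⟨⟨a, ha, hal.trans hlm⟩, a, ha, hal.trans hln⟩

theorem star_upSet (hN : IsCartanSemigroup N) (S : Set A) :
    star (upSet N S) = upSet N (star S) := by
  ext x
  constructor
  · rintro ⟨t, ht, h⟩
    exact ⟨star t, by simpa using ht, by simpa using h.star hN⟩
  · rintro ⟨t, ht, h⟩
    exact ⟨star t, ht, h.star hN⟩

namespace IsDomFilter

variable {F T U : Set A}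

theorem mem (hF : IsDomFilter N F) {m : A} (hm : m ∈ F) : m ∈ N := hF.1 hm

theorem up (hF : IsDomFilter N F) {m n : A} (hm : m ∈ F) (h : Dominated N m n) : n ∈ F :=
  ((hF.2 n h.right_mem n h.right_mem).2 ⟨m, hm, h, h⟩).1

theorem exists_lt (hF : IsDomFilter N F) {m n : A} (hm : m ∈ F) (hn : n ∈ F) :
    ∃ l ∈ F, Dominated N l m ∧ Dominated N l n :=
  (hF.2 m (hF.mem hm) n (hF.mem hn)).1 ⟨hm, hn⟩

theorem exists_lt_self (hF : IsDomFilter N F) {m : A} (hm : m ∈ F) : ∃ l ∈ F, Dominated N l m :=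
  (hF.exists_lt hm hm).imp fun _ h => ⟨h.1, h.2.1⟩

theorem upSet_eq (hF : IsDomFilter N F) : upSet N F = F :=
  Set.Subset.antisymm (fun _ ⟨_, ht, h⟩ => hF.up ht h) fun _ hm => hF.exists_lt_self hm

variable (hN : IsCartanSemigroup N)
include hN

theorem ne_iff (hF : IsDomFilter N F) : F ≠ N ↔ (0 : A) ∉ F := by
  refine not_congr ⟨fun h => h ▸ hN.zero_mem, fun h => ?_⟩
  exact Set.Subset.antisymm hF.1 fun n hn => hF.up h (.zero_left hN hn)

protected theorem star (hF : IsDomFilter N F) : IsDomFilter N (star F) := by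
  have h : IsDomFilter N (upSet N (star F)) := by
    refine isDomFilter_upSet fun a ha b hb => ?_
    obtain ⟨l, hl, hla, hlb⟩ := hF.exists_lt ha hb
    exact ⟨star l, by simpa using hl, by simpa using hla.star hN, by simpa using hlb.star hN⟩
  rwa [← star_upSet hN, hF.upSet_eq] at h

theorem exists_lt_mul (hT : IsDomFilter N T) (hU : IsDomFilter N U) {a b : A} (ha : a ∈ T * U)
    (hb : b ∈ T * U) : ∃ c ∈ T * U, Dominated N c a ∧ Dominated N c b := by
  obtain ⟨t, ht, u, hu, rfl⟩ := ha
  obtain ⟨t', ht', u', hu', rfl⟩ := hb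
  obtain ⟨x, hx, hxt, hxt'⟩ := hT.exists_lt ht ht'
  obtain ⟨y, hy, hyu, hyu'⟩ := hU.exists_lt hu hu'
  exact ⟨x * y, ⟨x, hx, y, hy, rfl⟩, hxt.mul hN hyu, hxt'.mul hN hyu'⟩

theorem upSet_mul (hT : IsDomFilter N T) (hU : IsDomFilter N U) :
    IsDomFilter N (upSet N (T * U)) :=
  isDomFilter_upSet fun _ ha _ hb => hT.exists_lt_mul hN hU ha hb

theorem mul_mem_upSet (hT : IsDomFilter N T) (hU : IsDomFilter N U) {t u : A} (ht : t ∈ T)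
    (hu : u ∈ U) : t * u ∈ upSet N (T * U) := by
  obtain ⟨c, hc, h, -⟩ := hT.exists_lt_mul hN hU (Set.mul_mem_mul ht hu) (Set.mul_mem_mul ht hu)
  exact ⟨c, hc, h⟩

theorem upSet_mul_upSet (hT : IsDomFilter N T) (hU : IsDomFilter N U) {V : Set A}
    (hV : IsDomFilter N V) : upSet N (upSet N (T * U) * V) = upSet N (T * upSet N (U * V)) := by
  ext p
  constructor
  · rintro ⟨_, ⟨x, ⟨_, ⟨t, ht, u, hu, rfl⟩, hx⟩, v, hv, rfl⟩, hp⟩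
    obtain ⟨v', hv', hvv⟩ := hV.exists_lt_self hv
    refine ⟨t * (u * v'), ⟨t, ht, _, hU.mul_mem_upSet hN hV hu hv', rfl⟩, ?_⟩
    rw [← mul_assoc]
    exact (hx.mul hN hvv).trans hp
  · rintro ⟨_, ⟨t, ht, x, ⟨_, ⟨u, hu, v, hv, rfl⟩, hx⟩, rfl⟩, hp⟩
    obtain ⟨t', ht', htt⟩ := hT.exists_lt_self ht
    refine ⟨t' * u * v, ⟨_, hT.mul_mem_upSet hN hU ht' hu, v, hv, rfl⟩, ?_⟩
    rw [mul_assoc]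
    exact (htt.mul hN hx).trans hp

/-- If `l < f` and `t ∈ T`, then `t*(tl) = (t*t)l` is still below `f`, as `t*t ∈ B`. -/
theorem subset_upSet_star_mul (hT : IsDomFilter N T) (hne : T.Nonempty) (hF : IsDomFilter N F) :
    F ⊆ upSet N (star T * upSet N (T * F)) := by
  intro f hf
  obtain ⟨t, ht⟩ := hne
  obtain ⟨l, hl, hlf⟩ := hF.exists_lt_self hf
  refine ⟨star t * (t * l), ⟨star t, by simpa using ht, _, hT.mul_mem_upSet hN hF ht hl, rfl⟩, ?_⟩
  rw [← mul_assoc]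
  exact hlf.mem_left_mul hN (star_mul_self_mem_semiCartan (hT.mem ht))

omit hN in
-- For `l ∈ F` below both `ac` and `f`, `l*` ends in `a*` and `l` begins with `f`, so `a*f = 0`
-- would force `l*l = 0`.
theorem star_mul_ne_zero (hF : IsDomFilter N F) (h0 : (0 : A) ∉ F) {a f c : A} (hac : a * c ∈ F)
    (hf : f ∈ F) : star a * f ≠ 0 := by
  intro h
  obtain ⟨l, hl, ⟨s, hs⟩, ⟨k, hk⟩⟩ := hF.exists_lt hac hf
  have h1 : star l * star s * star c * star a = star l := by
    conv_rhs => rw [← hs.right_eq]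
    simp only [star_mul, mul_assoc]
  have h2 : star l * l = 0 := by
    calc star l * l = star l * star s * star c * star a * (f * k * l) := by rw [h1, hk.right_eq]
      _ = star l * star s * star c * (star a * f) * k * l := by simp only [mul_assoc]
      _ = 0 := by simp [h]
  rw [CStarRing.star_mul_self_eq_zero_iff] at h2
  exact h0 (h2 ▸ hl)

theorem zero_notMem_star_mul (hT : IsDomFilter N T) (hU : IsDomFilter N U) (hne : U.Nonempty)
    (hF : IsDomFilter N F) (h0 : (0 : A) ∉ F) (h : upSet N (T * U) ⊆ F) :
    (0 : A) ∉ star T * F := by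
  rintro ⟨t, ht, f, hf, htf⟩
  obtain ⟨u, hu⟩ := hne
  have := hF.star_mul_ne_zero h0 (h (hT.mul_mem_upSet hN hU ht hu)) hf
  exact this (by simpa using htf)

omit hN in
theorem zero_notMem_star_mul_self (hF : IsDomFilter N F) (h0 : (0 : A) ∉ F) :
    (0 : A) ∉ star F * F := by
  rintro ⟨t, ht, f, hf, htf⟩
  obtain ⟨l, hl, ⟨s, hs⟩, -⟩ := hF.exists_lt ht hf
  refine hF.star_mul_ne_zero h0 (a := star t) (c := s * l) ?_ hf (by simpa using htf)
  rw [← mul_assoc, hs.right_eq]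
  exact hl

end IsDomFilter

/-! ## Ultrafilters -/

namespace IsDomUltrafilter

variable {T U : Set A} (hN : IsCartanSemigroup N)
include hN

theorem zero_notMem (hU : IsDomUltrafilter N U) : (0 : A) ∉ U :=
  (hU.isFilter.ne_iff hN).1 hU.proper

theorem eq_of_subset (hU : IsDomUltrafilter N U) {F : Set A} (hF : IsDomFilter N F)
    (h0 : (0 : A) ∉ F) (h : U ⊆ F) : F = U :=
  hU.maximal F hF ((hF.ne_iff hN).2 h0) h

omit hN in
theorem mk' (hN : IsCartanSemigroup N) (hne : U.Nonempty) (hU : IsDomFilter N U)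
    (h0 : (0 : A) ∉ U) (h : ∀ F, IsDomFilter N F → (0 : A) ∉ F → U ⊆ F → F ⊆ U) :
    IsDomUltrafilter N U :=
  ⟨hne, hU, (hU.ne_iff hN).2 h0, fun F hF hFN hUF =>
    (h F hF ((hF.ne_iff hN).1 hFN) hUF).antisymm hUF⟩

protected theorem star (hU : IsDomUltrafilter N U) : IsDomUltrafilter N (star U) := by
  refine .mk' hN hU.nonempty.star (hU.isFilter.star hN) (by simpa using hU.zero_notMem hN) ?_
  intro F hF h0 h
  have := hU.eq_of_subset hN (hF.star hN) (by simpa using h0) (by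
    simpa using Set.star_subset_star.2 h)
  rw [← this, star_star]

/-- Cancellation for an arbitrary proper filter above the product, not just the product itself: this
generality is what proves the product maximal. -/
theorem upSet_star_mul_eq (hT : IsDomFilter N T) (hne : T.Nonempty) (hU : IsDomUltrafilter N U)
    {F : Set A} (hF : IsDomFilter N F) (h0 : (0 : A) ∉ F) (h : upSet N (T * U) ⊆ F) :
    upSet N (star T * F) = U := by
  refine hU.eq_of_subset hN ((hT.star hN).upSet_mul hN hF) (fun h' => ?_) ?_
  · exact hT.zero_notMem_star_mul hN hU.isFilter hU.nonempty hF h0 h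
      (zero_mem_of_zero_mem_upSet h')
  · exact (hT.subset_upSet_star_mul hN hne hU.isFilter).trans
      (upSet_mono (Set.mul_subset_mul_left h))

theorem upSet_mul (hT : IsDomUltrafilter N T) (hU : IsDomUltrafilter N U)
    (h : (0 : A) ∉ T * U) : IsDomUltrafilter N (upSet N (T * U)) := by
  have hf := hT.isFilter.upSet_mul hN hU.isFilter
  refine .mk' hN ?_ hf (fun h' => h (zero_mem_of_zero_mem_upSet h')) ?_
  · obtain ⟨t, ht⟩ := hT.nonempty
    obtain ⟨u, hu⟩ := hU.nonempty
    exact ⟨_, hT.isFilter.mul_mem_upSet hN hU.isFilter ht hu⟩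
  · intro F hF h0 hTF
    have h1 := upSet_star_mul_eq hN hT.isFilter hT.nonempty hU hF h0 hTF
    have h2 := (hT.isFilter.star hN).subset_upSet_star_mul hN hT.nonempty.star hF
    rwa [h1, star_star] at h2

theorem upSet_star_mul_upSet (hT : IsDomUltrafilter N T) (hU : IsDomUltrafilter N U)
    (h : (0 : A) ∉ T * U) : upSet N (star T * upSet N (T * U)) = U :=
  upSet_star_mul_eq hN hT.isFilter hT.nonempty hU (hT.upSet_mul hN hU h).isFilter
    ((hT.upSet_mul hN hU h).zero_notMem hN) subset_rfl

omit hN in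
theorem zero_notMem_star_mul_star (h : (0 : A) ∉ T * U) : (0 : A) ∉ star U * star T := by
  rintro ⟨u, hu, t, ht, hut⟩
  exact h ⟨star t, ht, star u, hu, by simpa using congrArg star hut⟩

theorem star_upSet_mul (T U : Set A) : star (upSet N (T * U)) = upSet N (star U * star T) := by
  rw [star_upSet hN, Set.star_mul]

theorem upSet_upSet_mul_star (hT : IsDomUltrafilter N T) (hU : IsDomUltrafilter N U)
    (h : (0 : A) ∉ T * U) : upSet N (upSet N (T * U) * star U) = T := by
  have := upSet_star_mul_upSet hN (hU.star hN) (hT.star hN) (zero_notMem_star_mul_star h)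
  rw [← star_upSet_mul hN, ← star_upSet_mul hN] at this
  exact star_injective this

theorem zero_notMem_star_mul_upSet (hT : IsDomUltrafilter N T) (hU : IsDomUltrafilter N U)
    (h : (0 : A) ∉ T * U) : (0 : A) ∉ star T * upSet N (T * U) :=
  hT.isFilter.zero_notMem_star_mul hN hU.isFilter hU.nonempty (hT.upSet_mul hN hU h).isFilter
    ((hT.upSet_mul hN hU h).zero_notMem hN) subset_rfl

theorem zero_notMem_upSet_mul_star (hT : IsDomUltrafilter N T) (hU : IsDomUltrafilter N U)
    (h : (0 : A) ∉ T * U) : (0 : A) ∉ upSet N (T * U) * star U := by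
  have := zero_notMem_star_mul_star
    (zero_notMem_star_mul_upSet hN (hU.star hN) (hT.star hN) (zero_notMem_star_mul_star h))
  rwa [star_star, star_upSet_mul hN, star_star, star_star] at this

/-- If `tu < x` and `xv = 0`, then `tuv = 0`; but `t*tu ∈ U` by cancellation, contradicting `0 ∉
UV`. -/
theorem zero_notMem_upSet_mul_mul {V : Set A} (hT : IsDomUltrafilter N T)
    (hU : IsDomUltrafilter N U) (h : (0 : A) ∉ T * U) (h' : (0 : A) ∉ U * V) :
    (0 : A) ∉ upSet N (T * U) * V := by
  rintro ⟨x, ⟨_, ⟨t, ht, u, hu, rfl⟩, s, hs⟩, v, hv, hxv⟩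
  have h1 : t * u * v = 0 := by
    have h2 : t * u * s * x = t * u := hs.left_eq
    rw [← h2, mul_assoc, show x * v = 0 from hxv, mul_zero]
  have h2 : star t * (t * u) ∈ U :=
    (upSet_star_mul_upSet hN hT hU h).subset <|
      (hT.isFilter.star hN).mul_mem_upSet hN (hT.isFilter.upSet_mul hN hU.isFilter)
      (by simpa using ht) (hT.isFilter.mul_mem_upSet hN hU.isFilter ht hu)
  exact h' ⟨_, h2, v, hv, by simp only [mul_assoc] at h1 ⊢; rw [h1, mul_zero]⟩

theorem zero_notMem_mul_upSet_mul {V : Set A} (hU : IsDomUltrafilter N U)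
    (hV : IsDomUltrafilter N V) (h : (0 : A) ∉ T * U) (h' : (0 : A) ∉ U * V) :
    (0 : A) ∉ T * upSet N (U * V) := by
  have := zero_notMem_star_mul_star (zero_notMem_upSet_mul_mul hN (hV.star hN) (hU.star hN)
    (zero_notMem_star_mul_star h') (V := star T) (zero_notMem_star_mul_star h))
  rwa [star_star, star_upSet_mul hN, star_star, star_star] at this

end IsDomUltrafilter

/-- The groupoid of ultrafilters of a Cartan semigroup. -/
def ultrafilterGroupoid (hN : IsCartanSemigroup N) : ArrowGroupoid (DomUltrafilter N) where
  Comp T U := (0 : A) ∉ T.carrier * U.carrier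
  mul T U h := ⟨upSet N (T.carrier * U.carrier), T.2.upSet_mul hN U.2 h⟩
  inv U := ⟨star U.carrier, U.2.star hN⟩
  inv_inv U := Subtype.ext (star_star U.carrier)
  assoc T U V h h' :=
    ⟨T.2.zero_notMem_upSet_mul_mul hN U.2 h h', U.2.zero_notMem_mul_upSet_mul hN V.2 h h',
      Subtype.ext (T.2.isFilter.upSet_mul_upSet hN U.2.isFilter V.2.isFilter)⟩
  comp_inv_self U := U.2.isFilter.zero_notMem_star_mul_self (U.2.zero_notMem hN)
  comp_self_inv U := by
    have h := U.2.star hN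
    simpa using! h.isFilter.zero_notMem_star_mul_self (h.zero_notMem hN)
  inv_mul_cancel T U h :=
    ⟨T.2.zero_notMem_star_mul_upSet hN U.2 h, Subtype.ext (T.2.upSet_star_mul_upSet hN U.2 h)⟩
  mul_inv_cancel T U h :=
    ⟨T.2.zero_notMem_upSet_mul_star hN U.2 h, Subtype.ext (T.2.upSet_upSet_mul_star hN U.2 h)⟩

theorem isUltrafilterGroupoid_ultrafilterGroupoid (hN : IsCartanSemigroup N) :
    IsUltrafilterGroupoid N (ultrafilterGroupoid hN) where
  comp_iff _ _ := Iff.rfl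
  mul_eq _ _ _ := rfl
  inv_eq _ := Set.image_star.symm

end Cartan

section Cartan

variable {A : Type*} [NonUnitalCStarAlgebra A] {N : Set A}

/-! ## Units -/

theorem IsDomFilter.exists_lt_semiCartan {F : Set A} (hF : IsDomFilter N F) {b u : A} (hb : b ∈ F)
    (hbB : b ∈ semiCartan N) (hu : u ∈ F) : ∃ l ∈ F, l ∈ semiCartan N ∧ Dominated N l u := by
  obtain ⟨l, hl, hlb, hlu⟩ := hF.exists_lt hb hu
  exact ⟨l, hl, hlb.mem_semiCartan hbB, hlu⟩

/-- Once `U` meets `B`, each `u ∈ U` dominates some `l ∈ U ∩ B`, hence also `l*l`; so `U ⊆ (U*U)^<`,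
and maximality gives equality. -/
theorem mem_units_ultrafilterGroupoid_iff (hN : IsCartanSemigroup N) {U : DomUltrafilter N} :
    U ∈ (ultrafilterGroupoid hN).units ↔ ∃ b ∈ U.carrier, b ∈ semiCartan N := by
  constructor
  · rintro ⟨V, rfl⟩
    obtain ⟨v, hv⟩ := V.2.nonempty
    exact ⟨star v * v, (V.2.isFilter.star hN).mul_mem_upSet hN V.2.isFilter
      (Set.star_mem_star.2 hv) hv, star_mul_self_mem_semiCartan (V.2.isFilter.mem hv)⟩
  · rintro ⟨b, hb, hbB⟩
    refine ⟨U, Subtype.ext (U.2.eq_of_subset hN ((U.2.isFilter.star hN).upSet_mul hN U.2.isFilter)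
      (fun h => U.2.isFilter.zero_notMem_star_mul_self (U.2.zero_notMem hN)
        (zero_mem_of_zero_mem_upSet h)) fun u hu => ?_)⟩
    obtain ⟨l, hl, hlB, hlu⟩ := U.2.isFilter.exists_lt_semiCartan hb hbB hu
    exact ⟨star l * l, ⟨star l, Set.star_mem_star.2 hl, l, hl, rfl⟩,
      hlu.mem_left_mul hN (star_mem hlB)⟩

/-! ## The topology -/

theorem isOpen_basicOpen {n : A} (hn : n ∈ N) : IsOpen (basicOpen N n) :=
  TopologicalSpace.isOpen_generateFrom_of_mem ⟨n, hn, rfl⟩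

theorem DomUltrafilter.mem (U : DomUltrafilter N) {n : A} (hn : n ∈ U.carrier) : n ∈ N :=
  U.2.isFilter.mem hn

theorem isOpen_iff_exists_basicOpen {O : Set (DomUltrafilter N)} :
    IsOpen O ↔ ∀ U ∈ O, ∃ n ∈ U.carrier, basicOpen N n ⊆ O := by
  constructor
  · intro hO
    induction hO with
    | basic s hs =>
      obtain ⟨n, -, rfl⟩ := hs
      exact fun U hU => ⟨n, hU, subset_rfl⟩
    | univ => exact fun U _ => U.2.nonempty.imp fun n hn => ⟨hn, Set.subset_univ _⟩
    | inter s t _ _ hs ht =>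
      rintro U ⟨hUs, hUt⟩
      obtain ⟨m, hm, hms⟩ := hs U hUs
      obtain ⟨n, hn, hnt⟩ := ht U hUt
      obtain ⟨l, hl, hlm, hln⟩ := U.2.isFilter.exists_lt hm hn
      exact ⟨l, hl, fun V hV => ⟨hms (V.2.isFilter.up hV hlm), hnt (V.2.isFilter.up hV hln)⟩⟩
    | sUnion S _ hS =>
      rintro U ⟨s, hs, hUs⟩
      obtain ⟨n, hn, hns⟩ := hS s hs U hUs
      exact ⟨n, hn, hns.trans (Set.subset_sUnion_of_mem hs)⟩
  · intro h
    refine isOpen_iff_mem_nhds.2 fun U hU => ?_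
    obtain ⟨n, hn, hnO⟩ := h U hU
    exact Filter.mem_of_superset ((isOpen_basicOpen (U.mem hn)).mem_nhds hn) hnO

/-! ## Extension to ultrafilters -/

theorem IsDomFilter.exists_ultrafilter (hN : IsCartanSemigroup N) {F : Set A}
    (hF : IsDomFilter N F) (hne : F.Nonempty) (h0 : (0 : A) ∉ F) :
    ∃ U, IsDomUltrafilter N U ∧ F ⊆ U := by
  have hchain : ∀ c ⊆ {F : Set A | IsDomFilter N F ∧ (0 : A) ∉ F}, IsChain (· ⊆ ·) c →
      c.Nonempty → ∃ ub ∈ {F : Set A | IsDomFilter N F ∧ (0 : A) ∉ F}, ∀ s ∈ c, s ⊆ ub := by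
    intro c hc hchain _
    refine ⟨⋃₀ c, ⟨⟨Set.sUnion_subset fun s hs => (hc hs).1.1, fun m _ n _ => ⟨?_, ?_⟩⟩, ?_⟩,
      fun s hs => Set.subset_sUnion_of_mem hs⟩
    · rintro ⟨⟨s, hs, hms⟩, t, ht, hnt⟩
      obtain ⟨r, hr, hsr, htr⟩ := hchain.directedOn s hs t ht
      obtain ⟨l, hl, h⟩ := (hc hr).1.exists_lt (hsr hms) (htr hnt)
      exact ⟨l, ⟨r, hr, hl⟩, h⟩
    · rintro ⟨l, ⟨r, hr, hl⟩, hlm, hln⟩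
      exact ⟨⟨r, hr, (hc hr).1.up hl hlm⟩, r, hr, (hc hr).1.up hl hln⟩
    · rintro ⟨s, hs, h⟩
      exact (hc hs).2 h
  obtain ⟨U, hFU, hU⟩ := zorn_subset_nonempty _ hchain F ⟨hF, h0⟩
  exact ⟨U, .mk' hN (hne.mono hFU) hU.prop.1 hU.prop.2
    fun G hG hG0 hUG => hU.le_of_ge ⟨hG, hG0⟩ hUG, hFU⟩

/-! ### Factoring ultrafilters; products of open sets -/

section Product

variable (hN : IsCartanSemigroup N)
include hN

/-- Here `s` inverts `n` on the support of `l`, so left multiplication by `n` preserves domination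
of `l`. -/
theorem DominatesVia.mul_left {l t z s n : A} (h : DominatesVia N l t z) (hs : s ∈ N) (hn : n ∈ N)
    (hsn : s * n ∈ semiCartan N) (hns : n * s ∈ semiCartan N) (hl : l ∈ semiCartan N)
    (hlsn : l * (s * n) = l) : DominatesVia N (n * l) (t * s) (n * z) := by
  have hsnl : s * n * l = l := by rw [hN.comm hsn hl, hlsn]
  refine ⟨hN.mul_mem _ hn _ h.left_mem, hN.mul_mem _ h.via_mem _ hs, hN.mul_mem _ hn _ h.right_mem,
    ?_, ?_, ?_, ?_, ?_, ?_⟩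
  · have : t * s * (n * l) = t * (s * n * l) := by simp only [mul_assoc]
    rw [this, hsnl]; exact h.via_left
  · simpa only [mul_assoc] using hN.mul_mul_mem hs hns h.left_via
  · simpa only [mul_assoc] using hN.mul_mul_mem h.right_mem h.via_right hsn
  · simpa only [mul_assoc] using hN.mul_mul_mem hs hns h.right_via
  · calc n * z * (t * s) * (n * l) = n * (z * t * (s * n * l)) := by simp only [mul_assoc]
      _ = n * l := by rw [hsnl, h.right_eq]
  · calc n * l * (t * s) * (n * z) = n * ((l * t) * (s * n)) * z := by simp only [mul_assoc]
      _ = n * (s * n * l * t * z) := by rw [hN.comm h.left_via hsn]; simp only [mul_assoc]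
      _ = n * l := by rw [hsnl, h.left_eq]

theorem DominatesVia.mul_left_self {s n l : A} (hs : s ∈ N) (hn : n ∈ N)
    (hsn : s * n ∈ semiCartan N) (hns : n * s ∈ semiCartan N) (hl : l ∈ semiCartan N)
    (hlsn : l * (s * n) = l) : DominatesVia N (n * l) s n := by
  have hsnl : s * n * l = l := by rw [hN.comm hsn hl, hlsn]
  refine ⟨hN.mul_mem _ hn _ (hN.mem hl), hs, hn, ?_, hN.mul_mul_mem hs hns hl, hsn, hns, ?_, ?_⟩
  · rwa [← mul_assoc, hsnl]
  · rw [mul_assoc, ← mul_assoc s, hsnl]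
  · rw [mul_assoc, mul_assoc, hlsn]

/-- If `V` contains a product `m n'` with `n' < n`, then some ultrafilter containing `n` has the
same source as `V`. -/
theorem IsDomUltrafilter.exists_mem_zero_notMem {V : Set A} (hV : IsDomUltrafilter N V)
    {m n' n : A} (hmn : m * n' ∈ V) (h : Dominated N n' n) :
    ∃ U, IsDomUltrafilter N U ∧ n ∈ U ∧ (0 : A) ∉ V * star U := by
  obtain ⟨s, hs⟩ := h
  set Z := upSet N (star V * V)
  have hZ : IsDomFilter N Z := (hV.isFilter.star hN).upSet_mul hN hV.isFilter
  have hZ0 : (0 : A) ∉ Z := fun h => hV.isFilter.zero_notMem_star_mul_self (hV.zero_notMem hN)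
    (zero_mem_of_zero_mem_upSet h)
  have hVZ : ∀ v ∈ V, star v * v ∈ Z := fun v hv =>
    (hV.isFilter.star hN).mul_mem_upSet hN hV.isFilter (Set.star_mem_star.2 hv) hv
  set b := star (m * n') * (m * n') with hb
  have hbB : b ∈ semiCartan N := star_mul_self_mem_semiCartan (hV.isFilter.mem hmn)
  have hlB : ∀ l, Dominated N l b → l ∈ semiCartan N := fun l hl => hl.mem_semiCartan hbB
  have hlsn : ∀ l, Dominated N l b → l * (s * n) = l := by
    rintro l ⟨k, hk⟩
    have hbsn : b * (s * n) = b := by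
      calc b * (s * n) = star (m * n') * (m * (n' * s * n)) := by simp only [hb, mul_assoc]
        _ = b := by rw [hs.left_eq]
    calc l * (s * n) = l * k * b * (s * n) := by rw [hk.left_eq]
      _ = l * k * (b * (s * n)) := by simp only [mul_assoc]
      _ = l := by rw [hbsn, hk.left_eq]
  have hdom : ∀ l z, Dominated N l b → Dominated N l z → Dominated N (n * l) (n * z) := by
    rintro l z hl ⟨t, ht⟩
    exact ⟨_, ht.mul_left hN hs.via_mem hs.right_mem hs.via_right hs.right_via (hlB l hl)
      (hlsn l hl)⟩
  -- `Z` is the source of `V`, and `sn` acts as the identity on everything below `b ∈ Z`. So `nZ` is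
  -- directed and generates a proper filter containing `n`.
  set S := (fun z => n * z) '' Z
  have hdir : ∀ x ∈ S, ∀ y ∈ S, ∃ c ∈ S, Dominated N c x ∧ Dominated N c y := by
    rintro _ ⟨z, hz, rfl⟩ _ ⟨z', hz', rfl⟩
    obtain ⟨l, hl, hlz, hlz'⟩ := hZ.exists_lt hz hz'
    obtain ⟨k, hk, hkl, hkb⟩ := hZ.exists_lt hl (hVZ _ hmn)
    exact ⟨_, ⟨k, hk, rfl⟩, hdom _ _ hkb (hkl.trans hlz), hdom _ _ hkb (hkl.trans hlz')⟩
  have hSF : S ⊆ upSet N S := subset_upSet fun x hx =>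
    (hdir x hx x hx).imp fun _ h => ⟨h.1, h.2.1⟩
  have hnF : n ∈ upSet N S := by
    obtain ⟨l, hl, hlb⟩ := hZ.exists_lt_self (hVZ _ hmn)
    exact ⟨_, ⟨l, hl, rfl⟩, s, .mul_left_self hN hs.via_mem hs.right_mem hs.via_right hs.right_via
      (hlB l hlb) (hlsn l hlb)⟩
  have h0F : (0 : A) ∉ upSet N S := by
    intro h
    obtain ⟨z, hz, hnz⟩ := zero_mem_of_zero_mem_upSet h
    obtain ⟨l, hl, hlz, hlb⟩ := hZ.exists_lt hz (hVZ _ hmn)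
    have h1 := hdom _ _ hlb hlz
    rw [show n * z = 0 from hnz] at h1
    have h2 : l = 0 := by
      rw [← hlsn l hlb, hN.comm (hlB l hlb) hs.via_right, mul_assoc, h1.eq_zero, mul_zero]
    exact hZ0 (h2 ▸ hl)
  obtain ⟨U, hU, hFU⟩ := (isDomFilter_upSet hdir).exists_ultrafilter hN ⟨n, hnF⟩ h0F
  refine ⟨U, hU, hFU hnF, ?_⟩
  rintro ⟨v, hv, x, hx, hvx⟩
  obtain ⟨l, hl, ⟨t, ht⟩, hlb⟩ := hZ.exists_lt (hVZ v hv) (hVZ _ hmn)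
  obtain ⟨u, hu, ⟨h, hh⟩, ⟨k, hk⟩⟩ := hU.isFilter.exists_lt hx (hFU (hSF ⟨l, hl, rfl⟩))
  have hvu : v * star u = 0 := by
    have := (hh.star hN).right_eq
    rw [star_star] at this
    rw [← this, mul_assoc x, ← mul_assoc, show v * x = 0 from hvx, zero_mul]
  have hc := star_mul_self_mem_semiCartan (hU.isFilter.mem hu)
  -- Moving `u*u ∈ B` to the far right of this product exposes the factor `vu* = 0`.
  have h1 : star u * u = star u * u * (k * (n * l)) * (t * (star v * v)) := by
    have h3 : u * k * (n * (l * t * (star v * v))) = u := by rw [ht.left_eq]; exact hk.left_eq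
    conv_lhs => enter [2]; rw [← h3]
    simp only [mul_assoc]
  have h2 : star u * u = 0 := by
    rw [hN.comm hc hk.via_right, mul_assoc, hN.comm hc ht.via_right] at h1
    rw [h1]
    calc _ = k * (n * l) * (t * (star v * (v * star u) * u)) := by simp only [mul_assoc]
      _ = 0 := by simp [hvu]
  rw [CStarRing.star_mul_self_eq_zero_iff] at h2
  exact hU.zero_notMem hN (h2 ▸ hu)

/-- Products of elements with larger elements in a given ultrafilter come from a factorization of
that ultrafilter. -/
theorem IsDomUltrafilter.exists_upSet_mul_eq {V : Set A} (hV : IsDomUltrafilter N V)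
    {m' m n' n : A} (hmn : m' * n' ∈ V) (hm : Dominated N m' m) (hn : Dominated N n' n) :
    ∃ T U, IsDomUltrafilter N T ∧ IsDomUltrafilter N U ∧ m ∈ T ∧ n ∈ U ∧ (0 : A) ∉ T * U ∧
      upSet N (T * U) = V := by
  obtain ⟨U, hU, hnU, h0⟩ := hV.exists_mem_zero_notMem hN hmn hn
  refine ⟨upSet N (V * star U), U, hV.upSet_mul hN (hU.star hN) h0, hU, ?_, hnU, ?_, ?_⟩
  · obtain ⟨u, hu, ⟨k, hk⟩⟩ := hU.isFilter.exists_lt_self hnU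
    obtain ⟨s, hs⟩ := hn
    refine ⟨m' * n' * star u, ⟨_, hmn, star u, Set.star_mem_star.2 hu, rfl⟩, ?_⟩
    -- This form shows `n'u* ∈ B`, so `m'n'u*` is still dominated by `m`.
    have h1 : n' * star u = n * ((s * n') * star (k * u)) * star n := by
      conv_lhs => rw [← hs.right_eq, ← hk.right_eq]
      simp only [star_mul, mul_assoc]
    rw [mul_assoc, h1]
    exact hm.mul_right_mem hN
      (hN.mul_mul_star_mem hs.right_mem (mul_mem hs.via_left (star_mem hk.via_left)))
  · simpa using zero_notMem_upSet_mul_star hN hV (hU.star hN) h0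
  · simpa using upSet_upSet_mul_star hN hV (hU.star hN) h0

theorem isOpen_setMul {O P : Set (DomUltrafilter N)} (hO : IsOpen O) (hP : IsOpen P) :
    IsOpen ((ultrafilterGroupoid hN).setMul O P) := by
  rw [isOpen_iff_exists_basicOpen] at *
  rintro _ ⟨T, hT, U, hU, hTU, rfl⟩
  obtain ⟨m, hm, hmO⟩ := hO T hT
  obtain ⟨n, hn, hnP⟩ := hP U hU
  obtain ⟨m', hm', hmm⟩ := T.2.isFilter.exists_lt_self hm
  obtain ⟨n', hn', hnn⟩ := U.2.isFilter.exists_lt_self hn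
  refine ⟨m' * n', T.2.isFilter.mul_mem_upSet hN U.2.isFilter hm' hn', fun V hV => ?_⟩
  obtain ⟨T', U', hT', hU', hmT, hnU, h0, h⟩ := V.2.exists_upSet_mul_eq hN hV hmm hnn
  exact ⟨⟨T', hT'⟩, hmO hmT, ⟨U', hU'⟩, hnP hnU, h0, Subtype.ext h⟩

theorem isOpen_setInv {O : Set (DomUltrafilter N)} (hO : IsOpen O) :
    IsOpen ((ultrafilterGroupoid hN).setInv O) := by
  rw [isOpen_iff_exists_basicOpen] at *
  rintro _ ⟨U, hU, rfl⟩
  obtain ⟨n, hn, hnO⟩ := hO U hU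
  refine ⟨star n, Set.star_mem_star.2 hn, fun V hV =>
    ⟨(ultrafilterGroupoid hN).inv V, hnO ?_, (ultrafilterGroupoid hN).inv_inv V⟩⟩
  exact hV

theorem isBisection_of_subset_basicOpen {O : Set (DomUltrafilter N)} {n : A}
    (h : O ⊆ basicOpen N n) : (ultrafilterGroupoid hN).IsBisection O := by
  constructor
  · rintro _ ⟨_, ⟨T, hT, rfl⟩, U, hU, hTU, rfl⟩
    exact (mem_units_ultrafilterGroupoid_iff hN).2 ⟨star n * n,
      (T.2.isFilter.star hN).mul_mem_upSet hN U.2.isFilter (Set.star_mem_star.2 (h hT)) (h hU),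
      star_mul_self_mem_semiCartan (T.mem (h hT))⟩
  · rintro _ ⟨T, hT, _, ⟨U, hU, rfl⟩, hTU, rfl⟩
    exact (mem_units_ultrafilterGroupoid_iff hN).2 ⟨n * star n,
      T.2.isFilter.mul_mem_upSet hN (U.2.isFilter.star hN) (h hT) (Set.star_mem_star.2 (h hU)),
      hN.mul_star_self_mem (T.mem (h hT))⟩

theorem isEtale_ultrafilterGroupoid : (ultrafilterGroupoid hN).IsEtale := by
  -- All open subsets of the `𝒰ₙ` are taken, since closure under products then only needs `𝒰ₘ𝒰ₙ ⊆
  -- 𝒰ₘₙ`.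
  refine ⟨{O | IsOpen O ∧ ∃ n ∈ N, O ⊆ basicOpen N n}, ?_, ?_, ?_, ?_⟩
  · refine TopologicalSpace.isTopologicalBasis_of_isOpen_of_nhds (fun O hO => hO.1)
      fun U O hU hO => ?_
    obtain ⟨n, hn, hnO⟩ := isOpen_iff_exists_basicOpen.1 hO U hU
    exact ⟨basicOpen N n, ⟨isOpen_basicOpen (U.mem hn), n, U.mem hn, subset_rfl⟩, hn, hnO⟩
  · rintro O ⟨-, n, -, hn⟩
    exact isBisection_of_subset_basicOpen hN hn
  · rintro O ⟨hO, m, hm, hOm⟩ P ⟨hP, n, hn, hPn⟩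
    refine ⟨isOpen_setMul hN hO hP, m * n, hN.mul_mem m hm n hn, ?_⟩
    rintro _ ⟨T, hT, U, hU, hTU, rfl⟩
    exact T.2.isFilter.mul_mem_upSet hN U.2.isFilter (hOm hT) (hPn hU)
  · rintro O ⟨hO, n, hn, hOn⟩
    refine ⟨isOpen_setInv hN hO, star n, hN.star_mem n hn, ?_⟩
    rintro _ ⟨U, hU, rfl⟩
    exact Set.star_mem_star.2 (hOn hU)

end Product
end Cartan

/-! ### Module property of contractive projections onto commutative subalgebras -/

section Tomiyama

variable {D : Type*} [NonUnitalCommCStarAlgebra D]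

theorem NonUnitalCommCStarAlgebra.exists_char_apply_ne_zero {d : D} (hd : d ≠ 0) :
    ∃ χ : D →⋆ₙₐ[ℂ] ℂ, χ d ≠ 0 := by
  by_contra! h
  have h1 : WeakDual.gelfandTransform ℂ (Unitization ℂ D) (d : Unitization ℂ D) = 0 := by
    ext φ
    exact h ((φ : Unitization ℂ D →⋆ₙₐ[ℂ] ℂ).comp (Unitization.inrNonUnitalStarAlgHom ℂ D))
  have h2 := (gelfandTransform_isometry (Unitization ℂ D)).injective (h1.trans (map_zero _).symm)
  exact hd (Unitization.inr_injective h2)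

/-- A character has peaking functions that are small on a given element of its kernel. -/
theorem NonUnitalCommCStarAlgebra.exists_peak (χ : D →⋆ₙₐ[ℂ] ℂ) {d f : D} (hd : χ d ≠ 0)
    (hf : χ f = 0) {ε : ℝ} (hε : 0 < ε) :
    ∃ e : D, IsSelfAdjoint e ∧ ‖e‖ ≤ 1 ∧ χ e = 1 ∧ ‖f * e‖ ≤ ε := by
  let : PartialOrder D := CStarAlgebra.spectralOrder _
  let : StarOrderedRing D := CStarAlgebra.spectralOrderedRing _
  set e₀ : D := ((‖χ d‖ ^ 2)⁻¹ : ℝ) • (star d * d) with he₀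
  have hχe₀ : χ e₀ = 1 := by
    have : χ e₀ = (((‖χ d‖ ^ 2)⁻¹ : ℝ) : ℂ) * (star (χ d) * χ d) := by
      rw [he₀, ← Complex.coe_smul, map_smul, map_mul, map_star, smul_eq_mul]
    rw [this, Complex.star_def, Complex.conj_mul']
    have : (‖χ d‖ : ℂ) ≠ 0 := by simpa using hd
    push_cast
    field_simp
  have he₀n : 0 ≤ e₀ := smul_nonneg (by positivity) (star_mul_self_nonneg d)
  have hpos : 0 < ‖e₀‖ := norm_pos_iff.2 fun h => by simp [h] at hχe₀
  set K : ℝ := ‖e₀‖ / ε ^ 2 with hK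
  have hKpos : 0 < K := by positivity
  -- Clipping `p` to `[0, 1]` gives `e` with `epe ≥ 0`, so `K|fe|² ≤ e e₀ e`; `K` is chosen to turn
  -- this into `‖fe‖ ≤ ε`.
  set p : D := e₀ - K • (star f * f) with hp
  have hpsa : IsSelfAdjoint p :=
    he₀n.isSelfAdjoint.sub ((IsSelfAdjoint.all K).smul (.star_mul_self f))
  have hχp : χ p = 1 := by
    rw [hp, map_sub, hχe₀, ← Complex.coe_smul, map_smul, map_mul, hf, mul_zero, smul_zero, sub_zero]
  set g : ℝ → ℝ := fun t => max 0 (min t 1) with hg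
  have hgc : Continuous g := by fun_prop
  have hg0 : g 0 = 0 := by simp [hg]
  have hesa : IsSelfAdjoint (cfcₙ g p) := cfcₙ_predicate g p
  have hnorm : ‖cfcₙ g p‖ ≤ 1 := norm_cfcₙ_le fun t _ => by
    rw [Real.norm_eq_abs, abs_of_nonneg (le_max_left _ _)]
    simp [hg]
  refine ⟨cfcₙ g p, hesa, hnorm, ?_, ?_⟩
  · rw [NonUnitalStarAlgHom.map_cfcₙ χ g p hgc.continuousOn hg0
      (AddMonoidHomClass.continuous_of_bound χ 1 fun a => by
        simpa using NonUnitalStarAlgHom.norm_apply_le χ a) hpsa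
      (by rw [hχp]; exact IsSelfAdjoint.one ℂ), hχp, cfcₙ_eq_cfc, ← map_one (algebraMap ℝ ℂ),
      cfc_algebraMap]
    simp [hg]
  · set e := cfcₙ g p
    have h1 : 0 ≤ e * p * e := by
      have : e * p * e = cfcₙ (fun t => g t * t * g t) p := by
        rw [cfcₙ_mul .., cfcₙ_mul .., cfcₙ_id' ..]
      rw [this]
      refine cfcₙ_nonneg fun t _ => ?_
      rcases le_total 0 t with ht | ht
      · have : 0 ≤ g t := le_max_left _ _
        positivity
      · simp [hg, ht, ht.trans zero_le_one]
    have h2 : K • (star (f * e) * (f * e)) = e * e₀ * e - e * p * e := by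
      rw [star_mul, hesa.star_eq, hp, mul_sub, sub_mul, sub_sub_cancel, mul_smul_comm,
        smul_mul_assoc]
      simp only [mul_assoc]
    have h3 : ‖K • (star (f * e) * (f * e))‖ ≤ ‖e * e₀ * e‖ :=
      CStarAlgebra.norm_le_norm_of_nonneg_of_le (smul_nonneg hKpos.le (star_mul_self_nonneg _))
        (by rw [h2]; exact sub_le_self _ h1)
    have h4 : ‖e * e₀ * e‖ ≤ ‖e₀‖ := by
      calc ‖e * e₀ * e‖ ≤ ‖e‖ * ‖e₀‖ * ‖e‖ := norm_mul₃_le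
        _ ≤ 1 * ‖e₀‖ * 1 := by gcongr
        _ = ‖e₀‖ := by ring
    have h5 : ‖f * e‖ ^ 2 ≤ ε ^ 2 := by
      rw [norm_smul, Real.norm_of_nonneg hKpos.le, CStarRing.norm_star_mul_self, ← sq] at h3
      have := h3.trans h4
      rw [hK, div_mul_eq_mul_div, div_le_iff₀ (by positivity)] at this
      exact le_of_mul_le_mul_left this hpos
    exact le_of_sq_le_sq h5 hε.le

variable {A : Type*} [NonUnitalCStarAlgebra A] (ι : D →⋆ₙₐ[ℂ] A) (E : A →ₗ[ℂ] D)

/-- A contractive projection onto a commutative C*-subalgebra maps right multiples of elements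
of the kernel of a character to the kernel of that character. -/
theorem char_apply_expectation_mul_eq_zero (hE : ∀ a, ‖E a‖ ≤ ‖a‖) (hEι : ∀ d, E (ι d) = d)
    (χ : D →⋆ₙₐ[ℂ] ℂ) {f : D} (hf : χ f = 0) (x : A) : χ (E (x * ι f)) = 0 := by
  by_contra hw
  set w := χ (E (x * ι f)) with hwdef
  have hwpos : 0 < ‖w‖ := norm_pos_iff.2 hw
  have hι : ∀ d, ‖ι d‖ ≤ ‖d‖ := fun d => NonUnitalStarAlgHom.norm_apply_le ι d
  have hχ : ∀ d, ‖χ d‖ ≤ ‖d‖ := fun d => NonUnitalStarAlgHom.norm_apply_le χ d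
  obtain ⟨e, hesa, hen, hχe, hfe⟩ := NonUnitalCommCStarAlgebra.exists_peak χ hw hf
    (ε := ‖w‖ / (2 * (‖x‖ + 1))) (by positivity)
  set y := x * ι f with hy
  have hxfe : ‖y * star (ι e)‖ ≤ ‖w‖ / 2 := by
    rw [← map_star, hesa.star_eq, hy, mul_assoc, ← map_mul]
    calc ‖x * ι (f * e)‖ ≤ ‖x‖ * ‖ι (f * e)‖ := norm_mul_le _ _
      _ ≤ (‖x‖ + 1) * (‖w‖ / (2 * (‖x‖ + 1))) := by
          gcongr
          · linarith
          · exact (hι _).trans hfe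
      _ = ‖w‖ / 2 := by field_simp
  -- Perturb `y` by `T e` in the phase of `w`. The lower bound `(‖w‖ + T)²` has cross term `2T‖w‖`,
  -- while peaking limits the cross terms above to `T‖w‖`. Large `T` is then impossible.
  have key : ∀ T : ℝ, 0 ≤ T → T * ‖w‖ ≤ ‖y‖ ^ 2 := by
    intro T hT
    set c : ℂ := (T : ℂ) * (w / ‖w‖) with hc
    have hcn : ‖c‖ = T := by
      rw [hc, norm_mul, norm_div, Complex.norm_real, Complex.norm_real, Real.norm_of_nonneg hT,
        norm_norm, div_self hwpos.ne', mul_one]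
    have h1 : ‖w + c‖ = ‖w‖ + T := by
      have hw' : (‖w‖ : ℂ) ≠ 0 := by simpa using hw
      have : w + c = ((‖w‖ + T : ℝ) : ℂ) * (w / ‖w‖) := by
        rw [hc]; push_cast; field_simp
      rw [this, norm_mul, norm_div, Complex.norm_real, Complex.norm_real, norm_norm,
        div_self hwpos.ne', mul_one, Real.norm_of_nonneg (by positivity)]
    have h2 : ‖w + c‖ ≤ ‖y + c • ι e‖ := by
      have : w + c = χ (E (y + c • ι e)) := by
        rw [map_add, map_smul, hEι, map_add, map_smul, hχe, smul_eq_mul, mul_one]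
      rw [this]
      exact (hχ _).trans (hE _)
    have h3 : ‖y + c • ι e‖ ^ 2 ≤ ‖y‖ ^ 2 + T * ‖w‖ + T ^ 2 := by
      have hz : ‖y * star (c • ι e)‖ ≤ T * (‖w‖ / 2) := by
        rw [star_smul, mul_smul_comm, norm_smul, norm_star, hcn]
        gcongr
      have hz' : ‖c • ι e * star y‖ ≤ T * (‖w‖ / 2) := by
        rwa [← norm_star, star_mul, star_star]
      have hce : ‖c • ι e‖ ≤ T := by
        rw [norm_smul, hcn]
        exact mul_le_of_le_one_right hT ((hι e).trans hen)
      calc ‖y + c • ι e‖ ^ 2 = ‖(y + c • ι e) * star (y + c • ι e)‖ := by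
            rw [CStarRing.norm_self_mul_star, sq]
        _ = ‖y * star y + y * star (c • ι e) + c • ι e * star y + c • ι e * star (c • ι e)‖ := by
            rw [star_add, mul_add, add_mul, add_mul]; abel_nf
        _ ≤ ‖y * star y‖ + ‖y * star (c • ι e)‖ + ‖c • ι e * star y‖
            + ‖c • ι e * star (c • ι e)‖ := norm_add₄_le
        _ ≤ ‖y‖ ^ 2 + T * (‖w‖ / 2) + T * (‖w‖ / 2) + T ^ 2 := by
            rw [CStarRing.norm_self_mul_star, CStarRing.norm_self_mul_star, ← sq, ← sq]
            gcongr
        _ = _ := by ring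
    have h4 : (‖w‖ + T) ^ 2 ≤ ‖y + c • ι e‖ ^ 2 := by
      rw [← h1]; gcongr
    nlinarith [sq_nonneg ‖w‖]
  have := key ((‖y‖ ^ 2 + 1) / ‖w‖) (by positivity)
  rw [div_mul_cancel₀ _ hwpos.ne'] at this
  linarith

/-- Each character `χ` kills `bc - χ(c)b`, and characters separate the points of `D`. -/
theorem expectation_mul_mul (hE : ∀ a, ‖E a‖ ≤ ‖a‖) (hEι : ∀ d, E (ι d) = d) (x : A) (b c : D) :
    E (x * ι (b * c)) = E (x * ι b) * c := by
  by_contra h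
  obtain ⟨χ, hχ⟩ := NonUnitalCommCStarAlgebra.exists_char_apply_ne_zero (sub_ne_zero.2 h)
  have h1 := char_apply_expectation_mul_eq_zero ι E hE hEι χ (f := b * c - χ c • b)
    (by simp [mul_comm]) x
  apply hχ
  rw [map_sub, map_smul, mul_sub, map_sub, mul_smul_comm, map_smul, map_sub, map_smul] at h1
  rw [map_sub, map_mul χ, ← h1, smul_eq_mul, mul_comm (χ c)]

end Tomiyama

/-! ### The stable expectation as a `B`-module map -/

section Cartan

variable {A : Type*} [NonUnitalCStarAlgebra A] {N : Set A}

/-- `B` is a commutative C*-algebra. -/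
@[reducible]
noncomputable def IsCartanSemigroup.commCStarAlgebra (hN : IsCartanSemigroup N) :
    NonUnitalCommCStarAlgebra (semiCartan N) :=
  { (inferInstance : NonUnitalCStarAlgebra (semiCartan N)) with
    mul_comm := fun a b => Subtype.ext (hN.comm a.2 b.2) }

namespace IsStableExpectation

variable {E : A →ₗ[ℂ] A} (hE : IsStableExpectation N E)
include hE

theorem apply_mem (a : A) : E a ∈ semiCartan N :=
  hE.range_eq.subset (Set.mem_range_self a)

theorem apply_eq {b : A} (hb : b ∈ semiCartan N) : E b = b := by
  obtain ⟨a, rfl⟩ := hE.range_eq.superset hb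
  exact hE.idempotent a

theorem continuous : Continuous E :=
  AddMonoidHomClass.continuous_of_bound E 1 (by simpa using hE.contractive)

theorem apply_mul_mul (hN : IsCartanSemigroup N) (x : A) {b c : A} (hb : b ∈ semiCartan N)
    (hc : c ∈ semiCartan N) : E (x * (b * c)) = E (x * b) * c := by
  let := hN.commCStarAlgebra
  let ι : semiCartan N →⋆ₙₐ[ℂ] A := NonUnitalStarSubalgebraClass.subtype (semiCartan N)
  let E' : A →ₗ[ℂ] semiCartan N :=
    E.codRestrict (semiCartan N).toNonUnitalSubalgebra.toSubmodule hE.apply_mem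
  exact congrArg Subtype.val (expectation_mul_mul ι E' (fun a => hE.contractive a)
    (fun d => Subtype.ext (hE.apply_eq d.2)) x ⟨b, hb⟩ ⟨c, hc⟩)

/-- A stable expectation is a right `B`-module map on `N`. -/
theorem apply_mul (hN : IsCartanSemigroup N) {n c : A} (hn : n ∈ N) (hc : c ∈ semiCartan N) :
    E (n * c) = E n * c := by
  have hcl : IsClosed {x : A | E (x * c) = E x * c} :=
    isClosed_eq (hE.continuous.comp (by fun_prop)) (hE.continuous.mul continuous_const)
  refine hcl.closure_subset_iff.mpr ?_ (mem_closure_image_mul_semiCartan hn)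
  rintro _ ⟨d, hd, rfl⟩
  have h := hE.apply_mul_mul hN n (mul_mem (star_mul_self_mem_semiCartan hn) hd) hc
  simpa only [Set.mem_ofPred_eq, mul_assoc] using h

end IsStableExpectation
end Cartan

section Cartan

variable {A : Type*} [NonUnitalCStarAlgebra A] {N : Set A}

/-! ## Non-units and the Hausdorff property -/

theorem dominated_of_mul_mul_eq (hN : IsCartanSemigroup N) {l r z : A} (hl : l ∈ semiCartan N)
    (hr : r ∈ semiCartan N) (hz : z ∈ semiCartan N) (h : z * r * l = l) : Dominated N l z :=
  ⟨r, hN.mem hl, hN.mem hr, hN.mem hz, mul_mem hr hl, mul_mem hl hr, mul_mem hr hz, mul_mem hz hr,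
    h, by rw [mul_assoc, hN.comm hr hz, hN.comm hl (mul_mem hz hr), h]⟩

namespace IsStableExpectation

variable {E : A →ₗ[ℂ] A} (hE : IsStableExpectation N E) (hN : IsCartanSemigroup N)
include hE hN

/-- Domination between elements of `B` is witnessed in `B`. -/
theorem exists_mul_mul_eq {l z : A} (h : Dominated N l z) (hl : l ∈ semiCartan N) :
    ∃ r ∈ semiCartan N, z * r * l = l := by
  obtain ⟨t, ht⟩ := h
  refine ⟨E t, hE.apply_mem t, ?_⟩
  rw [mul_assoc, ← hE.apply_mul hN ht.via_mem hl, hE.apply_eq ht.via_left, ← mul_assoc,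
    ht.right_eq]

/-- Ultrafilters of units are prime with respect to orthogonal decompositions in `B`. -/
theorem mem_or_mem_of_mul_eq_zero {Z : Set A} (hZ : IsDomUltrafilter N Z) {f g : A}
    (hf : f ∈ semiCartan N) (hg : g ∈ semiCartan N) (hfg : f * g = 0) (h : f + g ∈ Z) :
    f ∈ Z ∨ g ∈ Z := by
  have hlB : f + g ∈ semiCartan N := add_mem hf hg
  have hfl : f * f = f * (f + g) := by rw [mul_add, hfg, add_zero]
  by_cases H : ∃ z ∈ Z, z * f = 0
  · right
    obtain ⟨z, hz, hzf⟩ := H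
    obtain ⟨w, hw, ⟨t, ht⟩, hwl⟩ := hZ.isFilter.exists_lt hz h
    have hwB := hwl.mem_semiCartan hlB
    obtain ⟨r, hr, hrw⟩ := hE.exists_mul_mul_eq hN hwl hwB
    have hwf : w * f = 0 := by rw [← ht.left_eq, mul_assoc, hzf, mul_zero]
    refine hZ.isFilter.up hw (dominated_of_mul_mul_eq hN hwB hr hg ?_)
    have : f * r * w = 0 := by rw [mul_assoc, hN.comm hf (mul_mem hr hwB), mul_assoc, hwf, mul_zero]
    rwa [add_mul, add_mul, this, zero_add] at hrw
  -- If no element of `Z` kills `f`, the products `zf` with `z ∈ Z ∩ B` generate a proper filter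
  -- containing `Z`, hence equal to `Z`; it contains `f`.
  · left
    push Not at H
    set S := (fun z => z * f) '' (Z ∩ semiCartan N)
    have key : ∀ l z, Dominated N l z → Dominated N l (f + g) → z ∈ semiCartan N →
        Dominated N (l * f) (z * f) := by
      intro l z hlz hl hz
      have hlB' := hl.mem_semiCartan hlB
      obtain ⟨t, ht, htl⟩ := hE.exists_mul_mul_eq hN hlz hlB'
      obtain ⟨r, hr, hrl⟩ := hE.exists_mul_mul_eq hN hl hlB'
      refine dominated_of_mul_mul_eq hN (mul_mem hlB' hf)
        -- Below `l`, `t` inverts `z` and `r` inverts `f + g`; since `f³ = f(f + g)²`, the element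
        -- `trrf` inverts `zf` on `lf`.
        (mul_mem ht (mul_mem hr (mul_mem hr hf))) (mul_mem hz hf) ?_
      let := hN.commCStarAlgebra
      lift f to semiCartan N using hf
      lift g to semiCartan N using hg
      lift l to semiCartan N using hlB'
      lift z to semiCartan N using hz
      lift t to semiCartan N using ht
      lift r to semiCartan N using hr
      norm_cast at *
      calc z * f * (t * (r * (r * f))) * (l * f) = (z * t * l) * r * r * f * (f * f) := by ac_rfl
        _ = l * r * r * f * (f * (f + g)) := by rw [htl, hfl]
        _ = r * l * r * (f * f) * (f + g) := by ac_rfl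
        _ = ((f + g) * r * ((f + g) * r * l)) * f := by rw [hfl]; ac_rfl
        _ = l * f := by rw [hrl, hrl]
    have hdir : ∀ x ∈ S, ∀ y ∈ S, ∃ c ∈ S, Dominated N c x ∧ Dominated N c y := by
      rintro _ ⟨z, ⟨hz, hzB⟩, rfl⟩ _ ⟨z', ⟨hz', hzB'⟩, rfl⟩
      obtain ⟨w, hw, hwz, hwz'⟩ := hZ.isFilter.exists_lt hz hz'
      obtain ⟨l, hl, hlw, hlfg⟩ := hZ.isFilter.exists_lt hw h
      exact ⟨_, ⟨l, ⟨hl, hlfg.mem_semiCartan hlB⟩, rfl⟩, key _ _ (hlw.trans hwz) hlfg hzB,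
        key _ _ (hlw.trans hwz') hlfg hzB'⟩
    have hFZ : upSet N S = Z := by
      refine hZ.eq_of_subset hN (isDomFilter_upSet hdir) (fun h0 => ?_) fun z hz => ?_
      · obtain ⟨z, hz, hzf⟩ := zero_mem_of_zero_mem_upSet h0
        exact H z hz.1 hzf
      · obtain ⟨l, hl, hlB', hlz⟩ := hZ.isFilter.exists_lt_semiCartan h hlB hz
        exact ⟨_, ⟨l, ⟨hl, hlB'⟩, rfl⟩, hlz.mul_right_mem hN hf⟩
    obtain ⟨l, hl, hlfg⟩ := hZ.isFilter.exists_lt_self h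
    have hlB' := hlfg.mem_semiCartan hlB
    obtain ⟨r, hr, hrl⟩ := hE.exists_mul_mul_eq hN hlfg hlB'
    rw [← hFZ]
    refine ⟨l * f, ⟨l, ⟨hl, hlB'⟩, rfl⟩, dominated_of_mul_mul_eq hN (mul_mem hlB' hf) hr hf ?_⟩
    let := hN.commCStarAlgebra
    lift f to semiCartan N using hf
    lift g to semiCartan N using hg
    lift l to semiCartan N using hlB'
    lift r to semiCartan N using hr
    norm_cast at *
    calc f * r * (l * f) = r * l * (f * f) := by ac_rfl
      _ = ((f + g) * r * l) * f := by rw [hfl]; ac_rfl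
      _ = l * f := by rw [hrl]

/-- An ultrafilter contains an element of `B` or an element of `N` annihilated by `E`. -/
theorem exists_mem_semiCartan_or_apply_eq_zero {U : Set A} (hU : IsDomUltrafilter N U) :
    (∃ b ∈ U, b ∈ semiCartan N) ∨ ∃ n ∈ U, E n = 0 := by
  obtain ⟨u, hu⟩ := hU.nonempty
  have huN := hU.isFilter.mem hu
  have hZ : IsDomUltrafilter N (upSet N (star U * U)) := (hU.star hN).upSet_mul hN hU
    (hU.isFilter.zero_notMem_star_mul_self (hU.zero_notMem hN))
  have huZ : ∀ z ∈ upSet N (star U * U), u * z ∈ U := by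
    intro z hz
    have h1 := hU.isFilter.mul_mem_upSet hN hZ.isFilter hu hz
    have h2 := (hU.star hN).upSet_star_mul_upSet hN hU
      (hU.isFilter.zero_notMem_star_mul_self (hU.zero_notMem hN))
    rw [star_star] at h2
    exact h2.subset h1
  have hbB : E u ∈ semiCartan N := hE.apply_mem u
  have hpB := star_mul_self_mem_semiCartan huN
  -- Stability puts `u E(u)*` in `B`, where `E` fixes it; the module property then evaluates it.
  have hub : u * star (E u) = E u * star (E u) := by
    have h : u * star (E u) ∈ semiCartan N := by simpa using star_mem (hE.stable u huN)
    rw [← hE.apply_mul hN huN (star_mem hbB), hE.apply_eq h]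
  set b := E u with hb
  set p := star u * u with hp
  set a := b * star b with ha
  have haB : a ∈ semiCartan N := mul_mem hbB (star_mem hbB)
  have haa : a * a = a * p := by
    have h1 : a * a = b * p * star b := by
      calc a * a = star (u * star b) * (u * star b) := by rw [hub]; simp [ha]
        _ = b * p * star b := by simp only [hp, star_mul, star_star, mul_assoc]
    rw [h1, mul_assoc, hN.comm hpB (star_mem hbB), ha, mul_assoc]
  have hpZ : p ∈ upSet N (star U * U) :=
    (hU.isFilter.star hN).mul_mem_upSet hN hU.isFilter (Set.star_mem_star.2 hu) hu
  obtain ⟨l, hl, hlp⟩ := hZ.isFilter.exists_lt_self hpZ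
  have hlB := hlp.mem_semiCartan hpB
  obtain ⟨q, hq, hql⟩ := hE.exists_mul_mul_eq hN hlp hlB
  -- As `q` inverts `p` below `l` and `a² = ap`, this is `l` cut down to the set where `a ≠ 0`.
  have hfB : l * q * a ∈ semiCartan N := mul_mem (mul_mem hlB hq) haB
  have hgB : l - l * q * a ∈ semiCartan N := sub_mem hlB hfB
  have hcomm : l * q * a * l = l * q * a * (l * q * a) ∧ a * l = a * (l * q * a) := by
    let := hN.commCStarAlgebra
    clear_value a p
    lift a to semiCartan N using haB
    lift p to semiCartan N using hpB
    lift l to semiCartan N using hlB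
    lift q to semiCartan N using hq
    norm_cast at *
    have h1 : a * l = a * (l * q * a) := by
      calc a * l = a * (p * q * l) := by rw [hql]
        _ = l * q * (a * p) := by ac_rfl
        _ = a * (l * q * a) := by rw [← haa]; ac_rfl
    exact ⟨by rw [mul_assoc, h1]; ac_rfl, h1⟩
  have hfg : l * q * a * (l - l * q * a) = 0 := by rw [mul_sub, hcomm.1, sub_self]
  rcases hE.mem_or_mem_of_mul_eq_zero hN hZ hfB hgB hfg (by simpa using hl) with hfZ | hgZ
  · left
    refine ⟨_, huZ _ hfZ, ?_⟩
    have h1 : u * (l * q * a) = a * b * (l * q) := by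
      calc u * (l * q * a) = u * (star b * b * (l * q)) := by
            rw [hN.comm (mul_mem hlB hq) haB, ha, hN.comm hbB (star_mem hbB)]
        _ = u * star b * b * (l * q) := by simp only [mul_assoc]
        _ = a * b * (l * q) := by rw [hub]
    rw [h1]
    exact mul_mem (mul_mem haB hbB) (mul_mem hlB hq)
  · right
    refine ⟨_, huZ _ hgZ, ?_⟩
    -- With `g = l - lqa`, `E(ug) = bg` and `(bg)*(bg) = g*ag`, which vanishes because `ag = 0`.
    rw [hE.apply_mul hN huN hgB, ← hb, ← CStarRing.star_mul_self_eq_zero_iff, star_mul, mul_assoc,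
      ← mul_assoc (star b), hN.comm (star_mem hbB) hbB, ← ha, mul_sub, hcomm.2, sub_self, mul_zero]

/-- For `l ∈ U ∩ B` with `l < n` via `s`, `l = E(nsl) = E(n)sl`. -/
theorem apply_ne_zero_of_mem {U : Set A} (hU : IsDomUltrafilter N U) {b n : A} (hb : b ∈ U)
    (hbB : b ∈ semiCartan N) (hn : n ∈ U) : E n ≠ 0 := by
  intro h
  obtain ⟨l, hl, hlB, ⟨s, hs⟩⟩ := hU.isFilter.exists_lt_semiCartan hb hbB hn
  have : l = 0 := by
    rw [← hE.apply_eq hlB, ← hs.right_eq, mul_assoc, hE.apply_mul hN hs.right_mem hs.via_left, h,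
      zero_mul]
  exact hU.zero_notMem hN (this ▸ hl)

theorem compl_units : (ultrafilterGroupoid hN).unitsᶜ = ⋃ n ∈ {n ∈ N | E n = 0}, basicOpen N n := by
  ext U
  simp only [Set.mem_compl_iff, mem_units_ultrafilterGroupoid_iff, Set.mem_iUnion,
    Set.mem_ofPred_eq, exists_prop]
  constructor
  · intro h
    obtain ⟨n, hn, h0⟩ := (hE.exists_mem_semiCartan_or_apply_eq_zero hN U.2).resolve_left h
    exact ⟨n, ⟨U.mem hn, h0⟩, hn⟩
  · rintro ⟨n, ⟨-, h0⟩, hn⟩ ⟨b, hb, hbB⟩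
    exact hE.apply_ne_zero_of_mem hN U.2 hb hbB hn h0

theorem t2Space : T2Space (DomUltrafilter N) := by
  refine ⟨fun T U hTU => ?_⟩
  have hself := fun V : DomUltrafilter N =>
    V.2.isFilter.zero_notMem_star_mul_self (V.2.zero_notMem hN)
  obtain ⟨t, ht, u, hu, hV⟩ : ∃ t ∈ T.carrier, ∃ u ∈ U.carrier,
      ∀ V : DomUltrafilter N, t ∈ V.carrier → u ∉ V.carrier := by
    by_cases h : (0 : A) ∈ star T.carrier * U.carrier
    · obtain ⟨x, hx, u, hu, hxu⟩ := h
      exact ⟨star x, hx, u, hu, fun V hxV huV => hself V ⟨x, hxV, u, huV, hxu⟩⟩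
    -- If `T⁻¹U` meets `B` then `T = U`. Otherwise it has some `xu` below an `n` with `E n = 0`, and
    -- an ultrafilter containing both `x*` and `u` would put `n` in its source, a unit.
    · have hW := (T.2.star hN).upSet_mul hN U.2 h
      rcases hE.exists_mem_semiCartan_or_apply_eq_zero hN hW with ⟨b, hb, hbB⟩ | ⟨n, hn, h0⟩
      · refine (hTU (Subtype.ext ?_)).elim
        have h1 := (T.2.star hN).upSet_star_mul_upSet hN U.2 h
        rw [star_star] at h1
        refine (T.2.eq_of_subset hN U.2.isFilter (U.2.zero_notMem hN) fun t ht => ?_).symm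
        obtain ⟨t', ht', htt⟩ := T.2.isFilter.exists_lt_self ht
        exact h1.subset ⟨t' * b, ⟨t', ht', b, hb, rfl⟩, htt.mul_right_mem hN hbB⟩
      · obtain ⟨_, ⟨x, hx, u, hu, rfl⟩, hxu⟩ := hn
        refine ⟨star x, hx, u, hu, fun V hxV huV => ?_⟩
        have hVV := (V.2.star hN).upSet_mul hN V.2 (hself V)
        exact hE.apply_ne_zero_of_mem hN hVV ((V.2.isFilter.star hN).mul_mem_upSet hN V.2.isFilter
          (Set.star_mem_star.2 huV) huV) (star_mul_self_mem_semiCartan (V.mem huV))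
          ⟨_, ⟨x, hxV, u, huV, rfl⟩, hxu⟩ h0
  exact ⟨basicOpen N t, basicOpen N u, isOpen_basicOpen (T.mem ht), isOpen_basicOpen (U.mem hu),
    ht, hu, Set.disjoint_left.2 hV⟩

end IsStableExpectation
end Cartan

/-- The ultrafilters of a Cartan semigroup form an étale groupoid, which is Hausdorff, and whose
non-unit elements are exactly the ultrafilters containing some `n ∈ N` with `E n = 0`. -/
theorem mainTheorem9 {A : Type*} [NonUnitalCStarAlgebra A] (N : Set A)
    (hN : IsCartanSemigroup N) (E : A →ₗ[ℂ] A) (hE : IsStableExpectation N E) :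
    ∃ 𝒢 : ArrowGroupoid (DomUltrafilter N),
      IsUltrafilterGroupoid N 𝒢 ∧
      𝒢.IsEtale ∧
      T2Space (DomUltrafilter N) ∧
      𝒢.unitsᶜ = ⋃ n ∈ {n ∈ N | E n = 0}, basicOpen N n :=
  ⟨ultrafilterGroupoid hN, isUltrafilterGroupoid_ultrafilterGroupoid hN,
    isEtale_ultrafilterGroupoid hN, hE.t2Space hN, hE.compl_units hN⟩
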